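/- Let $\Omega\subset\mathbb R^d$ be bounded and open and let $\Omega^\varepsilon\subset\Omega$ be open, for instance a periodically perforated Lipschitz domain (no further regularity is needed). Let $\Gamma^{\rm ext}=\partial\Omega^\varepsilon\cap\partial\Omega$ and let $V^\varepsilon$ be the space of all $u\in H^1(\Omega^\varepsilon)$ with $u=0$ on $\Gamma^{\rm ext}$, that is, the closure in $H^1(\Omega^\varepsilon)$ of the restrictions of functions in $C_c^\infty(\mathbb R^d\setminus\Gamma^{\rm ext})$ (for a Lipschitz domain: the functions with zero trace on $\Gamma^{\rm ext}$). Let $C_p\in[0,\infty]$ be the Poincaré constant of $V^\varepsilon$, i.e. the least $C$ with $\|u\|_{L^2(\Omega^\varepsilon)}^2\le C\|\nabla u\|_{L^2(\Omega^\varepsilon)}^2$ for all $u\in V^\varepsilon$ (with $C_p=\infty$, $C_p^{-1}=0$, if there is none). Let $\varepsilon>0$ and $\alpha\ge0$, and assume: (A1) $\mathbf A=(a_{ij}):\mathbb R^d\to\mathbb R^{d\times d}$ is essentially bounded, $[0,1]^d$-periodic, symmetric and globally Lipschitz, and $\underline\gamma|\xi|^2\le\sum_{i,j}a_{ij}(y)\xi_i\xi_j\le\overline\gamma|\xi|^2$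 for all $y,\xi\in\mathbb R^d$, with constants $\underline\gamma,\overline\gamma>0$. (A2) $\mathcal R:\mathbb R\to\mathbb R$ is degenerate at a point $x_0$ with constants $\delta_0,\delta_1>0$: $\mathcal R$ is locally absolutely continuous; $0\le\mathcal R'\le\delta_1$ a.e.; if at some $s$ both one-sided limits $\lim_{x\to s^\pm}\mathcal R'(x)$ exist and have product $0$, then $s=x_0$; and there is $r>0$ with $\delta_0\le\mathcal R'\le\delta_1$ a.e. outside $(x_0-r,x_0+r)$. (A3) $f\in L^2(\Omega)$. Let $\eta>0$ and $M=\eta+\varepsilon^\alpha\delta_1$. Let $(\gamma_k)_{k\ge1}$ be a non-increasing sequence of positive numbers and $\sigma>0$. For each $k\ge1$ let $\mathcal R_{\gamma_k}$ be a regularization of $\mathcal R$: it is locally absolutely continuous, $\gamma_k\delta_0\le\mathcal R_{\gamma_k}'\le\delta_1$ a.e., and $|\mathcal R-\mathcal R_{\gamma_k}|\le C'\gamma_k^\sigma$ on $\mathbb R$, with $C'$ independent of $k$. Suppose that for some $\omega\in(0,1)$ and some constant $C$ $$\frac{\gamma_{k-1}^\sigma}{\gamma_k}\le C\omega^k\quad(k\ge2),\qquad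 \overline\omega:=\omega+\sqrt{\frac{M}{\underline\gamma C_p^{-1}+M}}<1 .$$ Put $a(u,\varphi)=\int_{\Omega^\varepsilon}\mathbf A(x/\varepsilon)\nabla u\cdot\nabla\varphi\,dx$. Then there is exactly one sequence $(u_\varepsilon^k)_{k\ge0}$ with $u_\varepsilon^0=0$ and, for $k\ge1$, $u_\varepsilon^k\in V^\varepsilon$ and $$a(u_\varepsilon^k,\varphi)+M\langle u_\varepsilon^k,\varphi\rangle_{L^2(\Omega^\varepsilon)}=\langle f,\varphi\rangle_{L^2(\Omega^\varepsilon)}+M\langle u_\varepsilon^{k-1},\varphi\rangle_{L^2(\Omega^\varepsilon)}-\varepsilon^\alpha\langle\mathcal R_{\gamma_k}(u_\varepsilon^{k-1}),\varphi\rangle_{L^2(\Omega^\varepsilon)}\quad\text{for all }\varphi\in V^\varepsilon ;$$ this sequence is Cauchy in $H^1(\Omega^\varepsilon)$; and the problem $$-\nabla\cdot(\mathbf A(x/\varepsilon)\nabla u_\varepsilon)+\varepsilon^\alpha\mathcal R(u_\varepsilon)=f\ \text{in }\Omega^\varepsilon,\qquad \mathbf A(x/\varepsilon)\nabla u_\varepsilon\cdot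 n=0\ \text{on }\partial\Omega^\varepsilon\setminus\Gamma^{\rm ext},\qquad u_\varepsilon=0\ \text{on }\Gamma^{\rm ext},$$ has exactly one weak solution in $H^1(\Omega^\varepsilon)$, i.e. exactly one $u_\varepsilon\in V^\varepsilon$ with $a(u_\varepsilon,\varphi)+\varepsilon^\alpha\langle\mathcal R(u_\varepsilon),\varphi\rangle_{L^2(\Omega^\varepsilon)}=\langle f,\varphi\rangle_{L^2(\Omega^\varepsilon)}$ for all $\varphi\in V^\varepsilon$. -/

import Mathlib

open MeasureTheory Set Filter Topology
open scoped ENNReal NNReal Matrix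

namespace Microscopic

open scoped ContDiff

/-- `ℝ^d` with its Euclidean norm. -/
abbrev Space (d : ℕ) : Type := EuclideanSpace ℝ (Fin d)

/-- The coordinate vector `e_i` of `ℝ^d`. -/
noncomputable abbrev unitVec {d : ℕ} (i : Fin d) : Space d := EuclideanSpace.single i (1 : ℝ)

/-- `L²(Ω; ℝ)` -/
abbrev LTwo {d : ℕ} (Ω : Set (Space d)) : Type := Lp ℝ 2 (volume.restrict Ω)

/-- `L²(Ω; ℝ^d)` -/
abbrev LTwoVec {d : ℕ} (Ω : Set (Space d)) : Type := Lp (Space d) 2 (volume.restrict Ω)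

/-- `L²(Ω) × L²(Ω; ℝ^d)` with the norm `(‖u‖² + ‖g‖²)^(1/2)`. -/
abbrev LTwoPair {d : ℕ} (Ω : Set (Space d)) : Type := WithLp 2 (LTwo Ω × LTwoVec Ω)

lemma integrable_mul_test {d : ℕ} {Ω : Set (Space d)} {ψ : Space d → ℝ}
    (hc : Continuous ψ) (hs : HasCompactSupport ψ) (v : Space d → ℝ)
    (hv : MemLp v 2 (volume.restrict Ω)) :
    Integrable (fun x => v x * ψ x) (volume.restrict Ω) :=
  MemLp.integrable_mul (p := 2) (q := 2) hv (hc.memLp_of_hasCompactSupport hs)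

lemma memLp_coord {d : ℕ} {Ω : Set (Space d)} (g : LTwoVec Ω) (i : Fin d) :
    MemLp (fun x => g x i) 2 (volume.restrict Ω) :=
  (EuclideanSpace.proj (𝕜 := ℝ) i).comp_memLp' (Lp.memLp g)

lemma continuous_partial {d : ℕ} {φ : Space d → ℝ} (hφ : ContDiff ℝ ∞ φ) (i : Fin d) :
    Continuous (fun x => fderiv ℝ φ x (unitVec i)) :=
  (hφ.continuous_fderiv (by simp)).clm_apply continuous_const

/-- `H¹(Ω)`: the pairs `(u, ∇u)` of an `L²` function and its weak gradient in `L²`, with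
`‖u‖²_{H¹} = ‖u‖²_{L²} + ‖∇u‖²_{L²}`. -/
def H1 {d : ℕ} (Ω : Set (Space d)) : Submodule ℝ (LTwoPair Ω) where
  carrier := {p | ∀ φ : Space d → ℝ, ContDiff ℝ ∞ φ → HasCompactSupport φ → tsupport φ ⊆ Ω →
    ∀ i : Fin d, ∫ x in Ω, p.fst x * fderiv ℝ φ x (unitVec i) = - ∫ x in Ω, p.snd x i * φ x}
  zero_mem' := by
    intro φ h1 h2 h3 i
    have e1 : ∫ x in Ω, (0 : LTwo Ω) x * fderiv ℝ φ x (unitVec i) = 0 := by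
      refine integral_eq_zero_of_ae ?_
      filter_upwards [Lp.coeFn_zero ℝ 2 (volume.restrict Ω)] with x hx
      rw [hx]
      simp
    have e2 : ∫ x in Ω, (0 : LTwoVec Ω) x i * φ x = 0 := by
      refine integral_eq_zero_of_ae ?_
      filter_upwards [Lp.coeFn_zero (Space d) 2 (volume.restrict Ω)] with x hx
      rw [hx]
      simp
    simp only [WithLp.zero_fst, WithLp.zero_snd, e1, e2, neg_zero]
  add_mem' := by
    intro p q hp hq φ h1 h2 h3 i
    have hs : HasCompactSupport (fun x => fderiv ℝ φ x (unitVec i)) :=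
      h2.fderiv_apply (𝕜 := ℝ) (unitVec i)
    have hc := continuous_partial h1 i
    have e1 : ∫ x in Ω, (p.fst + q.fst) x * fderiv ℝ φ x (unitVec i) =
        (∫ x in Ω, p.fst x * fderiv ℝ φ x (unitVec i)) +
          ∫ x in Ω, q.fst x * fderiv ℝ φ x (unitVec i) := by
      rw [← integral_add (integrable_mul_test hc hs _ (Lp.memLp p.fst))
        (integrable_mul_test hc hs _ (Lp.memLp q.fst))]
      refine integral_congr_ae ?_
      filter_upwards [Lp.coeFn_add p.fst q.fst] with x hx
      simp only [hx, Pi.add_apply]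
      ring
    have e2 : ∫ x in Ω, (p.snd + q.snd) x i * φ x =
        (∫ x in Ω, p.snd x i * φ x) + ∫ x in Ω, q.snd x i * φ x := by
      rw [← integral_add (integrable_mul_test h1.continuous h2 _ (memLp_coord p.snd i))
        (integrable_mul_test h1.continuous h2 _ (memLp_coord q.snd i))]
      refine integral_congr_ae ?_
      filter_upwards [Lp.coeFn_add p.snd q.snd] with x hx
      simp only [hx, Pi.add_apply, PiLp.add_apply]
      ring
    simp only [WithLp.add_fst, WithLp.add_snd]
    rw [e1, e2, hp φ h1 h2 h3 i, hq φ h1 h2 h3 i]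
    ring
  smul_mem' := by
    intro c p hp φ h1 h2 h3 i
    have e1 : ∫ x in Ω, (c • p.fst) x * fderiv ℝ φ x (unitVec i) =
        c * ∫ x in Ω, p.fst x * fderiv ℝ φ x (unitVec i) := by
      rw [← integral_const_mul]
      refine integral_congr_ae ?_
      filter_upwards [Lp.coeFn_smul c p.fst] with x hx
      simp only [hx, Pi.smul_apply, smul_eq_mul]
      ring
    have e2 : ∫ x in Ω, (c • p.snd) x i * φ x = c * ∫ x in Ω, p.snd x i * φ x := by
      rw [← integral_const_mul]
      refine integral_congr_ae ?_
      filter_upwards [Lp.coeFn_smul c p.snd] with x hx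
      simp only [hx, Pi.smul_apply, PiLp.smul_apply, smul_eq_mul]
      ring
    simp only [WithLp.smul_fst, WithLp.smul_snd]
    rw [e1, e2, hp φ h1 h2 h3 i]
    ring

/-- The function underlying an element of `H¹(Ω)`. -/
noncomputable def value {d : ℕ} {Ω : Set (Space d)} (u : H1 Ω) : LTwo Ω := (u : LTwoPair Ω).fst

/-- The weak gradient of an element of `H¹(Ω)`. -/
noncomputable def grad {d : ℕ} {Ω : Set (Space d)} (u : H1 Ω) : LTwoVec Ω := (u : LTwoPair Ω).snd

/-- The exterior boundary `Γ^ext` of a perforated domain `Ωε ⊆ Ω`; the rest of the boundary of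
`Ωε` is the internal boundary. -/
def extBoundary {d : ℕ} (Ω Ωε : Set (Space d)) : Set (Space d) := frontier Ωε ∩ frontier Ω

/-- The elements of `H¹(Ωε)` that are restrictions of smooth functions on `ℝ^d` vanishing near
the set `Γ`. -/
def smoothVanishing {d : ℕ} (Ωε Γ : Set (Space d)) : Submodule ℝ (H1 Ωε) where
  carrier := {u | ∃ φ : Space d → ℝ, ContDiff ℝ ∞ φ ∧ HasCompactSupport φ ∧
    Disjoint (tsupport φ) Γ ∧ (value u : Space d → ℝ) =ᵐ[volume.restrict Ωε] φ}
  zero_mem' := ⟨0, contDiff_const, HasCompactSupport.zero, by simp,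
    Lp.coeFn_zero ℝ 2 (volume.restrict Ωε)⟩
  add_mem' := by
    rintro u v ⟨φ, h1, h2, h3, h4⟩ ⟨ψ, k1, k2, k3, k4⟩
    refine ⟨φ + ψ, h1.add k1, h2.add k2, ?_, ?_⟩
    · exact (Disjoint.union_left h3 k3).mono_left (tsupport_add φ ψ)
    · filter_upwards [Lp.coeFn_add (value u) (value v), h4, k4] with x hx hu hv
      have : value (u + v) x = value u x + value v x := hx
      rw [this, hu, hv, Pi.add_apply]
  smul_mem' := by
    rintro c u ⟨φ, h1, h2, h3, h4⟩
    refine ⟨fun x => c * φ x, contDiff_const.mul h1, h2.mul_left, ?_, ?_⟩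
    · exact h3.mono_left (tsupport_mul_subset_right (f := fun _ => c) (g := φ))
    · filter_upwards [Lp.coeFn_smul c (value u), h4] with x hx hu
      have : value (c • u) x = c * value u x := hx
      rw [this, hu]

/-- `V^ε`, the functions `u ∈ H¹(Ωε)` with `u = 0` on `Γ^ext`: the closure in `H¹(Ωε)` of the
restrictions of the smooth functions that vanish near `Γ^ext`. When `Ωε` is a Lipschitz domain this
is the space of the `u ∈ H¹(Ωε)` whose trace vanishes on `Γ^ext`. -/
noncomputable def V {d : ℕ} (Ω Ωε : Set (Space d)) : Submodule ℝ (H1 Ωε) :=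
  (smoothVanishing Ωε (extBoundary Ω Ωε)).topologicalClosure

/-- The Poincaré constant `C_p` of `V^ε`, that is the least `C ∈ [0, ∞]` such that
`‖u‖²_{L²} ≤ C ‖∇u‖²_{L²}` on `V^ε` (equal to `∞` if no finite `C` will do). -/
noncomputable def poincareConstant {d : ℕ} (Ω Ωε : Set (Space d)) : ℝ≥0∞ :=
  ⨅ (C : ℝ≥0) (_ : ∀ u ∈ V Ω Ωε, ‖value u‖ ^ 2 ≤ (C : ℝ) * ‖grad u‖ ^ 2), (C : ℝ≥0∞)

/-- Assumptions on the diffusion matrix: bounded, periodic with cell `Y = [0,1]^d`, symmetric,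
globally Lipschitz, uniformly elliptic with constants `γlo`, `γhi`. -/
structure IsDiffusion {d : ℕ} (A : Space d → Matrix (Fin d) (Fin d) ℝ) (γlo γhi : ℝ) : Prop where
  lo_pos : 0 < γlo
  hi_pos : 0 < γhi
  bounded : ∃ K : ℝ, ∀ᵐ y : Space d, ∀ i j, |A y i j| ≤ K
  periodic : ∀ (y : Space d) (m : Fin d), A (y + unitVec m) = A y
  symm : ∀ y, (A y).IsSymm
  lipschitz : ∃ K : ℝ≥0, ∀ i j, LipschitzWith K (fun y => A y i j)
  elliptic : ∀ (y ξ : Space d), γlo * ‖ξ‖ ^ 2 ≤ ∑ i, ∑ j, A y i j * ξ i * ξ j ∧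
    ∑ i, ∑ j, A y i j * ξ i * ξ j ≤ γhi * ‖ξ‖ ^ 2

/-- Local absolute continuity on `ℝ`; for such an `F` the a.e. derivative `deriv F` is the weak
derivative. -/
def LocallyAC (F : ℝ → ℝ) : Prop := ∀ a b : ℝ, AbsolutelyContinuousOnInterval F a b

/-- `F` is degenerate at `x₀` with constants `δ₀`, `δ₁`. The one-sided limits of `F'` are taken
along the points where `F'` exists. -/
structure IsDegenerate (F : ℝ → ℝ) (x₀ δ₀ δ₁ : ℝ) : Prop where
  ac : LocallyAC F
  delta_zero_pos : 0 < δ₀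
  delta_one_pos : 0 < δ₁
  deriv_bounds : ∀ᵐ x : ℝ, 0 ≤ deriv F x ∧ deriv F x ≤ δ₁
  degenerate_only_at : ∀ s lr ll : ℝ,
    Tendsto (deriv F) (𝓝[{x | s < x ∧ DifferentiableAt ℝ F x}] s) (𝓝 lr) →
    Tendsto (deriv F) (𝓝[{x | x < s ∧ DifferentiableAt ℝ F x}] s) (𝓝 ll) →
    lr * ll = 0 → s = x₀
  away : ∃ r : ℝ, 0 < r ∧
    ∀ᵐ x : ℝ, x ∉ Metric.ball x₀ r → δ₀ ≤ deriv F x ∧ deriv F x ≤ δ₁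

/-- `G` is a regularization `F_γ` of `F` at parameter `γ`, with error bound `C γ^σ`. -/
structure IsRegularization (F : ℝ → ℝ) (δ₀ δ₁ C σ γ : ℝ) (G : ℝ → ℝ) : Prop where
  ac : LocallyAC G
  deriv_bounds : ∀ᵐ x : ℝ, γ * δ₀ ≤ deriv G x ∧ deriv G x ≤ δ₁
  close : ∀ x : ℝ, |F x - G x| ≤ C * γ ^ σ

/-- The bilinear form `a(u, φ) = ∫_{Ωε} A(x/ε) ∇u · ∇φ dx`. -/
noncomputable def energyForm {d : ℕ} {Ωε : Set (Space d)} (A : Space d → Matrix (Fin d) (Fin d) ℝ)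
    (ε : ℝ) (u φ : H1 Ωε) : ℝ :=
  ∫ x in Ωε, (A (ε⁻¹ • x) *ᵥ (grad u x).ofLp) ⬝ᵥ (grad φ x).ofLp

/-- `⟨g, φ⟩_{L²(Ωε)}` for a function `g` and `φ ∈ H¹(Ωε)`. -/
noncomputable def pairing {d : ℕ} {Ωε : Set (Space d)} (g : Space d → ℝ) (φ : H1 Ωε) : ℝ :=
  ∫ x in Ωε, g x * value φ x

/-- Weak solution in `H¹(Ωε)` of the microscopic problem
`-∇·(A(x/ε)∇u) + ε^α R(u) = f` in `Ωε`, with zero flux across the internal boundary and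
`u = 0` on `Γ^ext`. -/
def IsWeakSolution {d : ℕ} (Ω Ωε : Set (Space d)) (A : Space d → Matrix (Fin d) (Fin d) ℝ)
    (ε α : ℝ) (R : ℝ → ℝ) (f : Space d → ℝ) (u : H1 Ωε) : Prop :=
  u ∈ V Ω Ωε ∧ ∀ φ ∈ V Ω Ωε,
    energyForm A ε u φ + ε ^ α * pairing (fun x => R (value u x)) φ = pairing f φ

/-- The sequence of linearized problems: `u⁰ = 0`, and for `k ≥ 1` the function `u^k` vanishes on
`Γ^ext` and solves, for all test functions `φ ∈ V^ε`,
`a(u^k, φ) + M⟨u^k, φ⟩ = ⟨f, φ⟩ + M⟨u^{k-1}, φ⟩ - ε^α ⟨R_{γ_k}(u^{k-1}), φ⟩`. -/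
def IsLinearizedSequence {d : ℕ} (Ω Ωε : Set (Space d))
    (A : Space d → Matrix (Fin d) (Fin d) ℝ) (ε α M : ℝ) (Rreg : ℝ → ℝ → ℝ) (γ : ℕ → ℝ)
    (f : Space d → ℝ) (u : ℕ → H1 Ωε) : Prop :=
  u 0 = 0 ∧ ∀ k : ℕ, 1 ≤ k → u k ∈ V Ω Ωε ∧ ∀ φ ∈ V Ω Ωε,
    energyForm A ε (u k) φ + M * pairing (value (u k)) φ =
      pairing f φ + M * pairing (value (u (k - 1))) φ
        - ε ^ α * pairing (fun x => Rreg (γ k) (value (u (k - 1)) x)) φ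

end Microscopic

/-! Adding M⟨u,φ⟩ to both sides turns the semilinear problem into a fixed-point equation w =
L(N(w)). Here L : L² → V^ε is the Lax–Milgram solution operator of a + M⟨·,·⟩
(`exists_solutionOperator`), and N(v) = f + Mv − ε^α R(v).

Since R is nondecreasing with slope at most δ₁ and M ≥ ε^α δ₁, the map s ↦ Ms − ε^α R(s) is
nondecreasing with slope at most M. Hence N is M-Lipschitz on L² (`norm_linearizedSource_sub_le`). A
Poincaré inequality with constant K bounds L, as a map L² → L², by (γlo/K + M)⁻¹. So L ∘ N contracts
L² with factor q = M/(γlo/K + M) < 1, and Banach's theorem gives the unique weak solution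
(`existsUnique_fixedPoint`).

Each linearized step is u^k = L(N_k(u^{k-1})), with R replaced by its regularization in N_k, so the
sequence is determined recursively. On a bounded domain N_k − N is bounded in L² by a multiple of
γ_k^σ, uniformly in the argument, and the rate condition makes this O(ω^k). The L² errors obey
e_{k+1} ≤ q e_k + b ω^k and tend to zero. As L maps boundedly into H¹, the convergence holds in H¹
(`tendsto_of_perturbed_iteration`); in particular the sequence is Cauchy. -/

namespace Microscopic

/-! ### Hilbert-space fixed points and perturbed iterations. -/

section Abstract

variable {W X : Type*} [NormedAddCommGroup W] [InnerProductSpace ℝ W]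
  [NormedAddCommGroup X] [InnerProductSpace ℝ X]

/-- Lax–Milgram on a closed subspace, for right-hand sides factoring through a map into another
Hilbert space. -/
theorem exists_solutionOperator [CompleteSpace W] [CompleteSpace X] {S : Submodule ℝ W}
    (hS : IsClosed (S : Set W)) (B : W →L[ℝ] W →L[ℝ] ℝ) {c : ℝ} (hc : 0 < c)
    (hB : ∀ w ∈ S, c * ‖w‖ ^ 2 ≤ B w w) (val : W →L[ℝ] X) :
    ∃ L : X →L[ℝ] W, ∀ g w, (w ∈ S ∧ ∀ φ ∈ S, B w φ = inner ℝ g (val φ)) ↔ w = L g := by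
  have : CompleteSpace S := hS.completeSpace_coe
  have hco : IsCoercive (B.bilinearComp S.subtypeL S.subtypeL) :=
    ⟨c, hc, fun w => by simpa [sq, mul_assoc] using hB w w.2⟩
  refine ⟨S.subtypeL ∘L (hco.continuousLinearEquivOfBilin.symm : S →L[ℝ] S) ∘L
    ContinuousLinearMap.adjoint (val ∘L S.subtypeL), fun g w => ?_⟩
  -- The adjoint supplies the Riesz representative in S of φ ↦ ⟨g, val φ⟩; the inverse Lax–Milgram
  -- map then solves for w.
  have key : ∀ w : S, (∀ φ ∈ S, B w φ = inner ℝ g (val φ)) ↔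
      w = hco.continuousLinearEquivOfBilin.symm
        (ContinuousLinearMap.adjoint (val ∘L S.subtypeL) g) := by
    intro w
    rw [ContinuousLinearEquiv.eq_symm_apply, ext_iff_inner_right ℝ]
    simp only [IsCoercive.continuousLinearEquivOfBilin_apply,
      ContinuousLinearMap.adjoint_inner_left]
    exact ⟨fun h φ => h φ φ.2, fun h φ hφ => h ⟨φ, hφ⟩⟩
  constructor
  · rintro ⟨hw, h⟩
    exact congrArg Subtype.val ((key ⟨w, hw⟩).1 h)
  · rintro rfl
    exact ⟨Subtype.property _, (key _).2 rfl⟩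

/-- If `val` is controlled by the form, the solution operator followed by `val` is bounded by the
inverse of the coercivity constant. -/
theorem norm_val_solution_le {S : Submodule ℝ W} {B : W →L[ℝ] W →L[ℝ] ℝ} {val : W →L[ℝ] X}
    {L : X →L[ℝ] W}
    (hL : ∀ g w, (w ∈ S ∧ ∀ φ ∈ S, B w φ = inner ℝ g (val φ)) ↔ w = L g) {κ : ℝ} (hκ : 0 < κ)
    (hB : ∀ w ∈ S, κ * ‖val w‖ ^ 2 ≤ B w w) (g : X) : ‖val (L g)‖ ≤ κ⁻¹ * ‖g‖ := by
  obtain ⟨hS, h1⟩ := (hL g (L g)).2 rfl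
  have h2 := hB (L g) hS
  rw [h1 _ hS] at h2
  have h3 := h2.trans (real_inner_le_norm g (val (L g)))
  rcases (norm_nonneg (val (L g))).eq_or_lt with h0 | h0
  · rw [← h0]
    positivity
  · rw [le_inv_mul_iff₀ hκ]
    refine le_of_mul_le_mul_right ?_ h0
    linarith

/-- The fixed-point problem `w = L (N (val w))` has a unique solution if `N` is Lipschitz with a
constant below the inverse of the norm of `val ∘ L`. -/
theorem existsUnique_fixedPoint [CompleteSpace X] {val : W →L[ℝ] X} {L : X →L[ℝ] W} {κ M : ℝ}
    (hM : 0 ≤ M) (hMκ : M < κ) (hL : ∀ g, ‖val (L g)‖ ≤ κ⁻¹ * ‖g‖) {N : X → X}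
    (hN : ∀ v v', ‖N v - N v'‖ ≤ M * ‖v - v'‖) : ∃! w : W, w = L (N (val w)) := by
  have hκ : 0 < κ := hM.trans_lt hMκ
  have hq : κ⁻¹ * M < 1 := by rw [inv_mul_lt_iff₀ hκ]; linarith
  have hq0 : 0 ≤ κ⁻¹ * M := by positivity
  -- The contraction runs in X, where the sharp bound on `val ∘ L` is available; its fixed point is
  -- lifted to W by `L ∘ N`.
  have hc : ContractingWith (NNReal.mk (κ⁻¹ * M) hq0) (fun v => val (L (N v))) := by
    refine ⟨NNReal.coe_lt_coe.1 hq, LipschitzWith.of_dist_le_mul fun v v' => ?_⟩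
    rw [dist_eq_norm, dist_eq_norm, ← map_sub, ← map_sub]
    refine (hL _).trans ?_
    rw [NNReal.coe_mk, mul_assoc]
    gcongr
    exact hN v v'
  have hfix : val (L (N hc.fixedPoint)) = hc.fixedPoint := hc.fixedPoint_isFixedPt
  refine ⟨L (N hc.fixedPoint), by simp only [hfix], fun w hw => ?_⟩
  have : val w = hc.fixedPoint := hc.fixedPoint_unique (x := val w) (congrArg val hw).symm
  rw [← this]
  exact hw

/-- Recursive sequences exist and are unique. -/
theorem existsUnique_recursive_sequence {β : Type*} (a : β) (s : ℕ → β → β) :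
    ∃! u : ℕ → β, u 0 = a ∧ ∀ k, u (k + 1) = s k (u k) := by
  refine ⟨fun k => Nat.rec a s k, ⟨rfl, fun _ => rfl⟩, fun u hu => ?_⟩
  funext k
  induction k with
  | zero => exact hu.1
  | succ k ih => rw [hu.2 k, ih]

/-- A real sequence that contracts up to a geometrically small error tends to zero. -/
theorem tendsto_zero_of_le_mul_add_geometric {e : ℕ → ℝ} (he : ∀ k, 0 ≤ e k) {q b ω : ℝ}
    (hq0 : 0 ≤ q) (hq : q < 1) (hb : 0 ≤ b) (hω0 : 0 ≤ ω) (hω : ω < 1)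
    (h : ∀ k, e (k + 1) ≤ q * e k + b * ω ^ k) : Tendsto e atTop (𝓝 0) := by
  -- A ratio strictly above both q and ω leaves the gap ρ − q that absorbs the forcing, even in the
  -- resonant case q = ω. The choice of D closes the induction through qD + D(ρ − q) = Dρ.
  obtain ⟨ρ, hρ, hρ1⟩ : ∃ ρ, max q ω < ρ ∧ ρ < 1 := exists_between (max_lt hq hω)
  have hqρ : q < ρ := (le_max_left _ _).trans_lt hρ
  have hωρ : ω < ρ := (le_max_right _ _).trans_lt hρ
  set D := max (e 0) (b / (ρ - q)) with hD
  have hD0 : 0 ≤ D := (he 0).trans (le_max_left _ _)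
  have hbD : b ≤ D * (ρ - q) := by
    rw [← div_le_iff₀ (by linarith)]
    exact le_max_right _ _
  have hle : ∀ k, e k ≤ D * ρ ^ k := by
    intro k
    induction k with
    | zero => rw [pow_zero, mul_one]; exact le_max_left _ _
    | succ k ih =>
      have hρk : 0 ≤ ρ ^ k := pow_nonneg (hω0.trans hωρ.le) k
      have h1 : b * ω ^ k ≤ b * ρ ^ k := by gcongr
      have h2 : b * ρ ^ k ≤ D * (ρ - q) * ρ ^ k := by gcongr
      have h3 : q * e k ≤ q * (D * ρ ^ k) := by gcongr
      calc e (k + 1) ≤ q * (D * ρ ^ k) + D * (ρ - q) * ρ ^ k := by linarith [h k]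
        _ = D * ρ ^ (k + 1) := by ring
  have hρ0 : 0 ≤ ρ := hω0.trans hωρ.le
  exact squeeze_zero he hle (by
    simpa using (tendsto_pow_atTop_nhds_zero_of_lt_one hρ0 hρ1).const_mul D)

/-- The rate condition on the regularization parameters makes `γ_k ^ σ` geometrically small. -/
theorem rpow_le_geometric {γ : ℕ → ℝ} {σ C ω : ℝ} (hγ_pos : ∀ k, 1 ≤ k → 0 < γ k)
    (hγ_anti : ∀ k, 1 ≤ k → γ (k + 1) ≤ γ k) (hω0 : 0 ≤ ω) (hω1 : ω ≤ 1) (hC : 0 ≤ C)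
    (hrate : ∀ k, 2 ≤ k → γ (k - 1) ^ σ / γ k ≤ C * ω ^ k) (k : ℕ) :
    γ (k + 1) ^ σ ≤ C * γ 1 * ω ^ k := by
  have hanti : ∀ k, γ (k + 1) ≤ γ 1 := by
    intro k
    induction k with
    | zero => rfl
    | succ k ih => exact (hγ_anti (k + 1) (by lia)).trans ih
  -- The rate bounds the previous parameter's power, hence the shift to k + 2; the factor γ_{k+2} is
  -- then bounded by γ_1.
  have h := hrate (k + 2) (by lia)
  rw [show k + 2 - 1 = k + 1 by lia, div_le_iff₀ (hγ_pos _ (by lia))] at h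
  calc γ (k + 1) ^ σ ≤ C * ω ^ (k + 2) * γ (k + 2) := h
    _ ≤ C * ω ^ k * γ 1 := by
      have h1 : ω ^ (k + 2) ≤ ω ^ k := pow_le_pow_of_le_one hω0 hω1 (by lia)
      have h2 := (hγ_pos (k + 2) (by lia)).le
      gcongr
      exact hanti (k + 1)
    _ = C * γ 1 * ω ^ k := by ring

/-- A perturbed fixed-point iteration converges to the fixed point of the limit problem. -/
theorem tendsto_of_perturbed_iteration {val : W →L[ℝ] X} {L : X →L[ℝ] W} {κ M : ℝ}
    (hM : 0 ≤ M) (hMκ : M < κ) (hL : ∀ g, ‖val (L g)‖ ≤ κ⁻¹ * ‖g‖) {N : X → X}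
    (hN : ∀ v v', ‖N v - N v'‖ ≤ M * ‖v - v'‖) {Nk : ℕ → X → X} {b ω : ℝ} (hb : 0 ≤ b)
    (hω0 : 0 ≤ ω) (hω : ω < 1) (hNk : ∀ k v, ‖Nk k v - N v‖ ≤ b * ω ^ k)
    {w : W} (hw : w = L (N (val w))) {u : ℕ → W} (hu : ∀ k, u (k + 1) = L (Nk k (val (u k)))) :
    Tendsto u atTop (𝓝 w) := by
  have hκ : 0 < κ := hM.trans_lt hMκ
  have hq : κ⁻¹ * M < 1 := by rw [inv_mul_lt_iff₀ hκ]; linarith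
  have hd : ∀ k, ‖Nk k (val (u k)) - N (val w)‖ ≤ M * ‖val (u k) - val w‖ + b * ω ^ k := by
    intro k
    have := norm_sub_le_norm_sub_add_norm_sub (Nk k (val (u k))) (N (val (u k))) (N (val w))
    linarith [hNk k (val (u k)), hN (val (u k)) (val w)]
  have he : Tendsto (fun k => ‖val (u k) - val w‖) atTop (𝓝 0) := by
    refine tendsto_zero_of_le_mul_add_geometric (q := κ⁻¹ * M) (b := κ⁻¹ * b)
      (fun _ => norm_nonneg _) (by positivity) hq (by positivity) hω0 hω fun k => ?_
    have h1 : val (u (k + 1)) - val w = val (L (Nk k (val (u k)) - N (val w))) := by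
      rw [hu k, map_sub, map_sub, ← hw]
    rw [h1]
    refine (hL _).trans ((mul_le_mul_of_nonneg_left (hd k) (by positivity)).trans_eq (by ring))
  have hg : Tendsto (fun k => ‖Nk k (val (u k)) - N (val w)‖) atTop (𝓝 0) := by
    refine squeeze_zero (fun _ => norm_nonneg _) hd ?_
    simpa using (he.const_mul M).add
      ((tendsto_pow_atTop_nhds_zero_of_lt_one hω0 hω).const_mul b)
  rw [← tendsto_add_atTop_iff_nat 1, hw]
  simp only [hu]
  -- The sources converge in X, so boundedness of L upgrades convergence of `val (u k)` to
  -- convergence in W.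
  exact (L.continuous.tendsto _).comp (tendsto_iff_norm_sub_tendsto_zero.2 hg)

end Abstract

/-! ### Slope bounds and superposition operators on L². -/

/-- A locally absolutely continuous function with derivative in `[0, δ]` a.e. is monotone with
slopes at most `δ`. -/
theorem LocallyAC.sub_mem_Icc {F : ℝ → ℝ} (hF : LocallyAC F) {δ : ℝ}
    (h : ∀ᵐ x : ℝ, 0 ≤ deriv F x ∧ deriv F x ≤ δ) {a b : ℝ} (hab : a ≤ b) :
    F b - F a ∈ Icc 0 (δ * (b - a)) := by
  rw [← (hF a b).integral_deriv_eq_sub]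
  constructor
  · exact intervalIntegral.integral_nonneg_of_ae hab (h.mono fun x hx => hx.1)
  · have := intervalIntegral.integral_mono_ae hab (hF a b).intervalIntegrable_deriv
      (intervalIntegrable_const (c := δ)) (h.mono fun x hx => hx.2)
    simpa [mul_comm] using this

/-- The reaction term of a stabilised linearization is Lipschitz with the stabilisation constant. -/
theorem abs_mul_sub_mul_le {F : ℝ → ℝ} {δ c M : ℝ} (hc : 0 ≤ c) (hM : c * δ ≤ M)
    (h : ∀ a b : ℝ, a ≤ b → F b - F a ∈ Icc 0 (δ * (b - a))) (s t : ℝ) :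
    |M * (s - t) - c * (F s - F t)| ≤ M * |s - t| := by
  -- Exchanging s and t only changes the sign inside the absolute value.
  wlog hts : t ≤ s generalizing s t
  · have := this t s (le_of_not_ge hts)
    rw [abs_sub_comm s t]
    refine (congrArg _ ?_).trans_le ((abs_neg _).trans_le this)
    ring
  obtain ⟨h1, h2⟩ := h t s hts
  have h3 : 0 ≤ c * (F s - F t) := mul_nonneg hc h1
  have h4 : c * (F s - F t) ≤ M * (s - t) :=
    (mul_le_mul_of_nonneg_left h2 hc).trans (by
      rw [← mul_assoc]; exact mul_le_mul_of_nonneg_right hM (by linarith))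
  rw [abs_of_nonneg (by linarith), abs_of_nonneg (by linarith : (0:ℝ) ≤ s - t)]
  linarith

section Nemytskii

variable {α : Type*} [MeasurableSpace α] {μ : Measure α}

open Classical in
/-- The superposition operator `v ↦ G ∘ v` on `L²`, with value `0` where `G ∘ v` is not in `L²`. -/
noncomputable def nemytskii (G : ℝ → ℝ) (v : Lp ℝ 2 μ) : Lp ℝ 2 μ :=
  if h : MemLp (fun x => G (v x)) 2 μ then h.toLp else 0

theorem memLp_comp_of_slope_bound [IsFiniteMeasure μ] {G : ℝ → ℝ} {δ : ℝ}
    (h : ∀ a b : ℝ, a ≤ b → G b - G a ∈ Icc 0 (δ * (b - a))) (v : Lp ℝ 2 μ) :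
    MemLp (fun x => G (v x)) 2 μ := by
  have hm : Monotone G := fun a b hab => by linarith [(h a b hab).1]
  have hmeas : AEStronglyMeasurable (fun x => G (v x)) μ :=
    (hm.measurable.comp_aemeasurable (Lp.aestronglyMeasurable v).aemeasurable).aestronglyMeasurable
  -- An affine majorant of |G ∘ v|; its constant term is in L² because the measure is finite.
  have hb : MemLp (fun x => δ * |v x| + |G 0|) 2 μ :=
    ((Lp.memLp v).abs.const_mul δ).add (memLp_const _)
  refine hb.mono hmeas (Eventually.of_forall fun x => ?_)
  rw [Real.norm_eq_abs, Real.norm_eq_abs]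
  refine le_trans ?_ (le_abs_self _)
  have h0 : |G (v x) - G 0| ≤ δ * |v x| := by
    rcases le_total 0 (v x) with hx | hx
    · obtain ⟨h1, h2⟩ := h _ _ hx
      rw [abs_of_nonneg h1, abs_of_nonneg hx]
      simpa using h2
    · obtain ⟨h1, h2⟩ := h _ _ hx
      rw [abs_sub_comm, abs_of_nonneg h1, abs_of_nonpos hx]
      simpa using h2
  calc |G (v x)| = |(G (v x) - G 0) + G 0| := by ring_nf
    _ ≤ |G (v x) - G 0| + |G 0| := abs_add_le _ _
    _ ≤ _ := by linarith

theorem coeFn_nemytskii [IsFiniteMeasure μ] {G : ℝ → ℝ} {δ : ℝ}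
    (h : ∀ a b : ℝ, a ≤ b → G b - G a ∈ Icc 0 (δ * (b - a))) (v : Lp ℝ 2 μ) :
    nemytskii G v =ᵐ[μ] fun x => G (v x) := by
  rw [nemytskii, dif_pos (memLp_comp_of_slope_bound h v)]
  exact MemLp.coeFn_toLp _

/-- The right-hand side `v ↦ F + M v - c G(v)` of a linearized problem. -/
noncomputable def linearizedSource (F : Lp ℝ 2 μ) (M c : ℝ) (G : ℝ → ℝ) (v : Lp ℝ 2 μ) :
    Lp ℝ 2 μ :=
  F + M • v - c • nemytskii G v

/-- The stabilising term absorbs the monotone reaction pointwise, so the nonlinearity adds nothing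
to the Lipschitz constant M. -/
theorem norm_linearizedSource_sub_le [IsFiniteMeasure μ] (F : Lp ℝ 2 μ) {G : ℝ → ℝ} {δ c M : ℝ}
    (hc : 0 ≤ c) (hM : c * δ ≤ M) (h : ∀ a b : ℝ, a ≤ b → G b - G a ∈ Icc 0 (δ * (b - a)))
    (v v' : Lp ℝ 2 μ) :
    ‖linearizedSource F M c G v - linearizedSource F M c G v'‖ ≤ M * ‖v - v'‖ := by
  have e : linearizedSource F M c G v - linearizedSource F M c G v' =
      M • (v - v') - c • (nemytskii G v - nemytskii G v') := by
    simp only [linearizedSource, smul_sub]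
    abel
  rw [e]
  refine Lp.norm_le_mul_norm_of_ae_le_mul ?_
  filter_upwards [coeFn_nemytskii h v, coeFn_nemytskii h v', Lp.coeFn_sub v v',
    Lp.coeFn_sub (nemytskii G v) (nemytskii G v'),
    Lp.coeFn_sub (M • (v - v')) (c • (nemytskii G v - nemytskii G v')),
    Lp.coeFn_smul M (v - v'), Lp.coeFn_smul c (nemytskii G v - nemytskii G v')]
    with x h1 h2 h3 h4 h5 h6 h7
  rw [h5, Pi.sub_apply, h6, h7, Pi.smul_apply, Pi.smul_apply, h4, h3, Pi.sub_apply, Pi.sub_apply,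
    h1, h2]
  exact abs_mul_sub_mul_le hc hM h (v x) (v' x)

/-- Only the reaction terms survive the subtraction; finite measure turns their uniform distance
into an L² bound independent of v. -/
theorem norm_linearizedSource_sub_le_of_close [IsFiniteMeasure μ] (F : Lp ℝ 2 μ) {G H : ℝ → ℝ}
    {δ c M b : ℝ} (hc : 0 ≤ c) (hG : ∀ a b : ℝ, a ≤ b → G b - G a ∈ Icc 0 (δ * (b - a)))
    (hH : ∀ a b : ℝ, a ≤ b → H b - H a ∈ Icc 0 (δ * (b - a))) (hGH : ∀ x, |H x - G x| ≤ b)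
    (v : Lp ℝ 2 μ) :
    ‖linearizedSource F M c G v - linearizedSource F M c H v‖ ≤
      c * (measureUnivNNReal μ ^ (2 : ℝ≥0∞).toReal⁻¹ * b) := by
  have e : linearizedSource F M c G v - linearizedSource F M c H v =
      c • (nemytskii H v - nemytskii G v) := by
    simp only [linearizedSource, smul_sub]
    abel
  rw [e, norm_smul, Real.norm_of_nonneg hc]
  refine mul_le_mul_of_nonneg_left ?_ hc
  refine Lp.norm_le_of_ae_bound ((abs_nonneg _).trans (hGH 0)) ?_
  filter_upwards [coeFn_nemytskii hG v, coeFn_nemytskii hH v,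
    Lp.coeFn_sub (nemytskii H v) (nemytskii G v)] with x h1 h2 h3
  rw [h3, Pi.sub_apply, h1, h2]
  exact hGH _

end Nemytskii

end Microscopic

namespace Microscopic

open scoped ContDiff

/-! ### Completeness of H¹ and the Poincaré inequality. -/

section Sobolev

variable {d : ℕ}

/-- `H¹(Ω)` is closed in `L²(Ω) × L²(Ω; ℝ^d)`. -/
theorem isClosed_H1 (Ω : Set (Space d)) : IsClosed (H1 Ω : Set (LTwoPair Ω)) := by
  have hset : (H1 Ω : Set (LTwoPair Ω)) = ⋂ (φ : Space d → ℝ) (_ : ContDiff ℝ ∞ φ)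
      (_ : HasCompactSupport φ) (_ : tsupport φ ⊆ Ω) (i : Fin d),
      {p | ∫ x in Ω, p.fst x * fderiv ℝ φ x (unitVec i) = - ∫ x in Ω, p.snd x i * φ x} := by
    ext p
    simp only [mem_iInter, mem_ofPred_eq]
    rfl
  rw [hset]
  refine isClosed_iInter fun φ => isClosed_iInter fun h1 => isClosed_iInter fun h2 =>
    isClosed_iInter fun _ => isClosed_iInter fun i => isClosed_eq ?_ (Continuous.neg ?_)
  -- Each side is, up to sign, the inner product with a fixed L² element built from the test
  -- function, hence continuous in p.
  · have hm : MemLp (fun x => fderiv ℝ φ x (unitVec i)) 2 (volume.restrict Ω) :=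
      (continuous_partial h1 i).memLp_of_hasCompactSupport (h2.fderiv_apply (𝕜 := ℝ) (unitVec i))
    have : (fun p : LTwoPair Ω => ∫ x in Ω, p.fst x * fderiv ℝ φ x (unitVec i)) =
        fun p => inner ℝ hm.toLp (WithLp.fstL 2 ℝ (LTwo Ω) (LTwoVec Ω) p) := by
      funext p
      rw [L2.inner_def]
      refine integral_congr_ae ?_
      filter_upwards [hm.coeFn_toLp] with x hx
      rw [hx]
      rfl
    rw [this]
    fun_prop
  · have hm : MemLp (fun x => φ x • unitVec i) 2 (volume.restrict Ω) :=
      (h1.continuous.smul continuous_const).memLp_of_hasCompactSupport h2.smul_right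
    have : (fun p : LTwoPair Ω => ∫ x in Ω, p.snd x i * φ x) =
        fun p => inner ℝ hm.toLp (WithLp.sndL 2 ℝ (LTwo Ω) (LTwoVec Ω) p) := by
      funext p
      rw [L2.inner_def]
      refine integral_congr_ae ?_
      filter_upwards [hm.coeFn_toLp] with x hx
      rw [hx, inner_smul_left, EuclideanSpace.inner_single_left]
      simp [mul_comm]
    rw [this]
    fun_prop

instance (Ω : Set (Space d)) : CompleteSpace (H1 Ω) :=
  (isClosed_H1 Ω).completeSpace_coe

/-- `value` as a continuous linear map. -/
noncomputable def valueL (Ω : Set (Space d)) : H1 Ω →L[ℝ] LTwo Ω :=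
  WithLp.fstL 2 ℝ (LTwo Ω) (LTwoVec Ω) ∘L (H1 Ω).subtypeL

/-- `grad` as a continuous linear map. -/
noncomputable def gradL (Ω : Set (Space d)) : H1 Ω →L[ℝ] LTwoVec Ω :=
  WithLp.sndL 2 ℝ (LTwo Ω) (LTwoVec Ω) ∘L (H1 Ω).subtypeL

theorem norm_sq_eq_value_add_grad {Ω : Set (Space d)} (u : H1 Ω) :
    ‖u‖ ^ 2 = ‖value u‖ ^ 2 + ‖grad u‖ ^ 2 :=
  WithLp.prod_norm_sq_eq_of_L2 (u : LTwoPair Ω)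

/-- A non-trivial inverse Poincaré constant provides a Poincaré inequality. -/
theorem exists_poincare {Ω Ωε : Set (Space d)} (h : ((poincareConstant Ω Ωε)⁻¹).toReal ≠ 0) :
    ∃ K : ℝ, 0 < K ∧ ∀ u ∈ V Ω Ωε, ‖value u‖ ^ 2 ≤ K * ‖grad u‖ ^ 2 := by
  have hlt : poincareConstant Ω Ωε < ⊤ := by
    rw [lt_top_iff_ne_top]
    intro h0
    simp [h0] at h
  simp only [poincareConstant, iInf_lt_iff] at hlt
  obtain ⟨K, hK, -⟩ := hlt
  -- An admissible constant may be 0; enlarging it makes division by it legitimate.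
  refine ⟨K + 1, by positivity, fun u hu => (hK u hu).trans ?_⟩
  gcongr
  linarith

end Sobolev

/-! ### The oscillating coefficient as a bounded operator on L². -/

section Coefficients

variable {d : ℕ} {A : Space d → Matrix (Fin d) (Fin d) ℝ} {γlo γhi : ℝ}

theorem IsDiffusion.continuous_entry (hA : IsDiffusion A γlo γhi) (i j : Fin d) :
    Continuous (fun y => A y i j) := by
  obtain ⟨K, hK⟩ := hA.lipschitz
  exact (hK i j).continuous

/-- A set of full Lebesgue measure is dense, and continuity of the entries makes this one closed, so
the a.e. bound holds everywhere. -/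
theorem IsDiffusion.exists_bound (hA : IsDiffusion A γlo γhi) :
    ∃ K : ℝ, ∀ y i j, |A y i j| ≤ K := by
  obtain ⟨K, hK⟩ := hA.bounded
  have hcl : IsClosed {y | ∀ i j, |A y i j| ≤ K} := by
    simp only [ofPred_forall]
    exact isClosed_iInter fun i => isClosed_iInter fun j =>
      isClosed_le (hA.continuous_entry i j).abs continuous_const
  have hd : Dense {y | ∀ i j, |A y i j| ≤ K} := Measure.dense_of_ae hK
  refine ⟨K, fun y => ?_⟩
  have : y ∈ {y | ∀ i j, |A y i j| ≤ K} := by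
    rw [← hcl.closure_eq]
    exact hd y
  exact this

/-- Expansion in constant operators transfers continuity and bounds from the entries to the
operator-valued coefficient. -/
theorem toEuclideanCLM_eq_sum (m : Matrix (Fin d) (Fin d) ℝ) :
    Matrix.toEuclideanCLM (𝕜 := ℝ) m = ∑ i, ∑ j, m i j •
      Matrix.toEuclideanCLM (𝕜 := ℝ) (Matrix.single i j (1 : ℝ)) := by
  conv_lhs => rw [Matrix.matrix_eq_sum_single m]
  simp only [map_sum, ← map_smul, Matrix.smul_single, smul_eq_mul, mul_one]

theorem IsDiffusion.memLp_top (hA : IsDiffusion A γlo γhi) (ε : ℝ) (μ : Measure (Space d)) :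
    MemLp (fun x => Matrix.toEuclideanCLM (𝕜 := ℝ) (A (ε⁻¹ • x))) ∞ μ := by
  obtain ⟨K, hK⟩ := hA.exists_bound
  refine memLp_top_of_bound (Continuous.aestronglyMeasurable ?_)
    (∑ i, ∑ j, K * ‖Matrix.toEuclideanCLM (𝕜 := ℝ)
      (Matrix.single (i : Fin d) (j : Fin d) (1 : ℝ))‖) (Eventually.of_forall fun x => ?_)
  · simp only [toEuclideanCLM_eq_sum (A _)]
    exact continuous_finsetSum _ fun i _ => continuous_finsetSum _ fun j _ =>
      ((hA.continuous_entry i j).comp (continuous_const_smul _)).smul continuous_const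
  · rw [toEuclideanCLM_eq_sum]
    refine (norm_sum_le _ _).trans (Finset.sum_le_sum fun i _ =>
      (norm_sum_le _ _).trans (Finset.sum_le_sum fun j _ => ?_))
    rw [norm_smul]
    exact mul_le_mul_of_nonneg_right (hK _ i j) (norm_nonneg _)

/-- Multiplication by the oscillating coefficient `A(x/ε)` on `L²(Ωε; ℝ^d)`. -/
noncomputable def coefficientMul (hA : IsDiffusion A γlo γhi) (ε : ℝ) (Ωε : Set (Space d)) :
    LTwoVec Ωε →L[ℝ] LTwoVec Ωε :=
  (ContinuousLinearMap.id ℝ (Space d →L[ℝ] Space d)).holderL (volume.restrict Ωε) ∞ 2 2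
    (hA.memLp_top ε (volume.restrict Ωε)).toLp

theorem coeFn_coefficientMul (hA : IsDiffusion A γlo γhi) (ε : ℝ) (Ωε : Set (Space d))
    (g : LTwoVec Ωε) : coefficientMul hA ε Ωε g =ᵐ[volume.restrict Ωε]
      fun x => Matrix.toEuclideanCLM (𝕜 := ℝ) (A (ε⁻¹ • x)) (g x) := by
  filter_upwards [ContinuousLinearMap.coeFn_holder (r := 2)
    (ContinuousLinearMap.id ℝ (Space d →L[ℝ] Space d))
    (hA.memLp_top ε (volume.restrict Ωε)).toLp g,
    (hA.memLp_top ε (volume.restrict Ωε)).coeFn_toLp] with x h1 h2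
  rw [coefficientMul, ContinuousLinearMap.holderL_apply_apply, h1, h2]
  rfl

theorem energyForm_eq_inner (hA : IsDiffusion A γlo γhi) (ε : ℝ) {Ωε : Set (Space d)}
    (u φ : H1 Ωε) :
    energyForm A ε u φ = inner ℝ (coefficientMul hA ε Ωε (grad u)) (grad φ) := by
  rw [L2.inner_def, energyForm]
  refine integral_congr_ae ?_
  filter_upwards [coeFn_coefficientMul hA ε Ωε (grad u)] with x hx
  rw [hx, real_inner_comm, real_inner_comm, EuclideanSpace.inner_eq_star_dotProduct,
    Matrix.ofLp_toEuclideanCLM, dotProduct_comm]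
  rfl

theorem le_energyForm_self (hA : IsDiffusion A γlo γhi) (ε : ℝ) {Ωε : Set (Space d)}
    (u : H1 Ωε) : γlo * ‖grad u‖ ^ 2 ≤ energyForm A ε u u := by
  rw [energyForm_eq_inner hA, ← real_inner_self_eq_norm_sq, ← real_inner_smul_left]
  rw [L2.inner_def, L2.inner_def]
  refine integral_mono_ae (L2.integrable_inner _ _) (L2.integrable_inner _ _) ?_
  filter_upwards [coeFn_coefficientMul hA ε Ωε (grad u), Lp.coeFn_smul γlo (grad u)] with x h1 h2
  rw [h1, h2, Pi.smul_apply, real_inner_smul_left, real_inner_self_eq_norm_sq, real_inner_comm,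
    Matrix.inner_toEuclideanCLM]
  refine (hA.elliptic (ε⁻¹ • x) (grad u x)).1.trans_eq ?_
  simp only [dotProduct, Matrix.mulVec, Finset.mul_sum]
  exact Finset.sum_congr rfl fun i _ => Finset.sum_congr rfl fun j _ => by ring

end Coefficients

theorem pairing_eq_inner {d : ℕ} {Ωε : Set (Space d)} {g : Space d → ℝ} {G : LTwo Ωε}
    (h : G =ᵐ[volume.restrict Ωε] g) (φ : H1 Ωε) : pairing g φ = inner ℝ G (value φ) := by
  rw [L2.inner_def, pairing]
  refine integral_congr_ae ?_
  filter_upwards [h] with x hx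
  rw [hx, real_inner_comm]
  rfl

/-! ### The variational problems as fixed-point equations. -/

section Problem

variable {d : ℕ} {A : Space d → Matrix (Fin d) (Fin d) ℝ} {γlo γhi : ℝ}

/-- The form `a(u, φ) + M ⟨u, φ⟩`. -/
noncomputable def shiftedForm (hA : IsDiffusion A γlo γhi) (ε M : ℝ) (Ωε : Set (Space d)) :
    H1 Ωε →L[ℝ] H1 Ωε →L[ℝ] ℝ :=
  (innerSL ℝ).bilinearComp (coefficientMul hA ε Ωε ∘L gradL Ωε) (gradL Ωε) +
    M • (innerSL ℝ).bilinearComp (valueL Ωε) (valueL Ωε)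

theorem shiftedForm_apply (hA : IsDiffusion A γlo γhi) (ε M : ℝ) {Ωε : Set (Space d)}
    (u φ : H1 Ωε) :
    shiftedForm hA ε M Ωε u φ = energyForm A ε u φ + M * inner ℝ (value u) (value φ) := by
  rw [energyForm_eq_inner hA]
  rfl

theorem shiftedForm_self_ge (hA : IsDiffusion A γlo γhi) (ε M : ℝ) {Ωε : Set (Space d)}
    (u : H1 Ωε) : γlo * ‖grad u‖ ^ 2 + M * ‖value u‖ ^ 2 ≤ shiftedForm hA ε M Ωε u u := by
  rw [shiftedForm_apply, real_inner_self_eq_norm_sq]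
  linarith [le_energyForm_self hA ε u]

theorem mul_norm_sq_le_shiftedForm (hA : IsDiffusion A γlo γhi) (ε M : ℝ)
    {Ωε : Set (Space d)} (u : H1 Ωε) : min γlo M * ‖u‖ ^ 2 ≤ shiftedForm hA ε M Ωε u u := by
  refine le_trans ?_ (shiftedForm_self_ge hA ε M u)
  rw [norm_sq_eq_value_add_grad, mul_add, add_comm]
  gcongr
  · exact min_le_left _ _
  · exact min_le_right _ _

/-- The gradient energy is spent on the L² norm; the surplus γlo/K over M is what makes the
iteration contract. -/
theorem mul_norm_value_sq_le_shiftedForm (hA : IsDiffusion A γlo γhi) (ε M : ℝ)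
    {Ωε : Set (Space d)} {K : ℝ} (hK0 : 0 < K) {u : H1 Ωε}
    (hK : ‖value u‖ ^ 2 ≤ K * ‖grad u‖ ^ 2) :
    (γlo / K + M) * ‖valueL Ωε u‖ ^ 2 ≤ shiftedForm hA ε M Ωε u u := by
  refine le_trans ?_ (shiftedForm_self_ge hA ε M u)
  change (γlo / K + M) * ‖value u‖ ^ 2 ≤ _
  have h := mul_le_mul_of_nonneg_left hK (div_pos hA.lo_pos hK0).le
  rw [← mul_assoc, div_mul_cancel₀ _ hK0.ne'] at h
  linarith

/-- The linearized variational equation in terms of the shifted form. -/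
theorem linearized_iff_shiftedForm (hA : IsDiffusion A γlo γhi) (ε M c δ : ℝ)
    {Ωε : Set (Space d)} [IsFiniteMeasure (volume.restrict Ωε)] {f : Space d → ℝ} {F : LTwo Ωε}
    (hF : F =ᵐ[volume.restrict Ωε] f) {G : ℝ → ℝ}
    (hG : ∀ a b : ℝ, a ≤ b → G b - G a ∈ Icc 0 (δ * (b - a))) (v : LTwo Ωε) (u φ : H1 Ωε) :
    energyForm A ε u φ + M * pairing (value u) φ =
        pairing f φ + M * pairing v φ - c * pairing (fun x => G (v x)) φ ↔
      shiftedForm hA ε M Ωε u φ = inner ℝ (linearizedSource F M c G v) (valueL Ωε φ) := by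
  change _ ↔ _ = inner ℝ (linearizedSource F M c G v) (value φ)
  rw [shiftedForm_apply, linearizedSource, inner_sub_left, inner_add_left, real_inner_smul_left,
    real_inner_smul_left, pairing_eq_inner hF, pairing_eq_inner (coeFn_nemytskii hG v),
    pairing_eq_inner (EventuallyEq.refl _ (v : Space d → ℝ)),
    pairing_eq_inner (EventuallyEq.refl _ (value u : Space d → ℝ))]

theorem isLinearizedSequence_iff {Ω Ωε : Set (Space d)} [IsFiniteMeasure (volume.restrict Ωε)]
    (hA : IsDiffusion A γlo γhi) {ε α M δ : ℝ} {Rreg : ℝ → ℝ → ℝ} {γ : ℕ → ℝ} {f : Space d → ℝ}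
    {F : LTwo Ωε} (hF : F =ᵐ[volume.restrict Ωε] f)
    (hG : ∀ k, 1 ≤ k → ∀ a b : ℝ, a ≤ b →
      Rreg (γ k) b - Rreg (γ k) a ∈ Icc 0 (δ * (b - a)))
    {L : LTwo Ωε →L[ℝ] H1 Ωε}
    (hL : ∀ g w, (w ∈ V Ω Ωε ∧ ∀ φ ∈ V Ω Ωε, shiftedForm hA ε M Ωε w φ =
      inner ℝ g (valueL Ωε φ)) ↔ w = L g) (u : ℕ → H1 Ωε) :
    IsLinearizedSequence Ω Ωε A ε α M Rreg γ f u ↔ u 0 = 0 ∧ ∀ k,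
      u (k + 1) = L (linearizedSource F M (ε ^ α) (Rreg (γ (k + 1))) (valueL Ωε (u k))) := by
  have h (k : ℕ) : (u (k + 1) ∈ V Ω Ωε ∧ ∀ φ ∈ V Ω Ωε,
      energyForm A ε (u (k + 1)) φ + M * pairing (value (u (k + 1))) φ =
        pairing f φ + M * pairing (value (u k)) φ
          - ε ^ α * pairing (fun x => Rreg (γ (k + 1)) (value (u k) x)) φ) ↔
      u (k + 1) = L (linearizedSource F M (ε ^ α) (Rreg (γ (k + 1))) (valueL Ωε (u k))) := by
    rw [← hL]
    exact and_congr_right fun _ => forall₂_congr fun φ _ =>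
      linearized_iff_shiftedForm hA ε M (ε ^ α) δ hF (hG (k + 1) (by lia)) _ _ φ
  refine and_congr_right fun _ => ⟨fun hu k => (h k).1 (hu (k + 1) (by lia)), fun hu k hk => ?_⟩
  obtain ⟨k, rfl⟩ := Nat.exists_eq_add_of_le' hk
  exact (h k).2 (hu k)

theorem isWeakSolution_iff {Ω Ωε : Set (Space d)} [IsFiniteMeasure (volume.restrict Ωε)]
    (hA : IsDiffusion A γlo γhi) {ε α M δ : ℝ} {R : ℝ → ℝ} {f : Space d → ℝ}
    {F : LTwo Ωε} (hF : F =ᵐ[volume.restrict Ωε] f)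
    (hR : ∀ a b : ℝ, a ≤ b → R b - R a ∈ Icc 0 (δ * (b - a)))
    {L : LTwo Ωε →L[ℝ] H1 Ωε}
    (hL : ∀ g w, (w ∈ V Ω Ωε ∧ ∀ φ ∈ V Ω Ωε, shiftedForm hA ε M Ωε w φ =
      inner ℝ g (valueL Ωε φ)) ↔ w = L g) (u : H1 Ωε) :
    IsWeakSolution Ω Ωε A ε α R f u ↔
      u = L (linearizedSource F M (ε ^ α) R (valueL Ωε u)) := by
  rw [← hL]
  refine and_congr_right fun _ => forall₂_congr fun φ _ => ?_
  refine Iff.trans ?_ (linearized_iff_shiftedForm hA ε M (ε ^ α) δ hF hR (value u) u φ)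
  -- The term M⟨u,φ⟩ stands on both sides and cancels.
  constructor <;> intro h <;> linarith

end Problem

end Microscopic

theorem mainTheorem1 {d : ℕ} (Ω Ωε : Set (Microscopic.Space d))
    (hΩ_open : IsOpen Ω) (hΩ_bdd : Bornology.IsBounded Ω)
    (hΩε_open : IsOpen Ωε) (hΩε_sub : Ωε ⊆ Ω)
    (ε α : ℝ) (hε : 0 < ε) (hα : 0 ≤ α)
    (A : Microscopic.Space d → Matrix (Fin d) (Fin d) ℝ) (γlo γhi : ℝ)
    (hA : Microscopic.IsDiffusion A γlo γhi)
    (R : ℝ → ℝ) (x₀ δ₀ δ₁ : ℝ) (hR : Microscopic.IsDegenerate R x₀ δ₀ δ₁)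
    (f : Microscopic.Space d → ℝ) (hf : MemLp f 2 (volume.restrict Ω))
    (η M : ℝ) (hη : 0 < η) (hM : M = η + ε ^ α * δ₁)
    (γ : ℕ → ℝ) (hγ_pos : ∀ k, 1 ≤ k → 0 < γ k) (hγ_anti : ∀ k, 1 ≤ k → γ (k + 1) ≤ γ k)
    (Rreg : ℝ → ℝ → ℝ) (CR σ : ℝ) (hσ : 0 < σ)
    (hRreg : ∀ k, 1 ≤ k → Microscopic.IsRegularization R δ₀ δ₁ CR σ (γ k) (Rreg (γ k)))
    (C ω : ℝ) (hω_pos : 0 < ω) (hω_lt : ω < 1)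
    (hγ_rate : ∀ k, 2 ≤ k → γ (k - 1) ^ σ / γ k ≤ C * ω ^ k)
    (hω_bar : ω + Real.sqrt
      (M / (γlo * ((Microscopic.poincareConstant Ω Ωε)⁻¹).toReal + M)) < 1) :
    (∃! u : ℕ → Microscopic.H1 Ωε,
      Microscopic.IsLinearizedSequence Ω Ωε A ε α M Rreg γ f u) ∧
    (∀ u : ℕ → Microscopic.H1 Ωε,
      Microscopic.IsLinearizedSequence Ω Ωε A ε α M Rreg γ f u → CauchySeq u) ∧
    (∃! u : Microscopic.H1 Ωε, Microscopic.IsWeakSolution Ω Ωε A ε α R f u) := by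
  open Microscopic in
  have hc : 0 < ε ^ α := Real.rpow_pos_of_pos hε α
  have hδ₁ := hR.delta_one_pos
  have hMpos : 0 < M := by rw [hM]; positivity
  have hcM : ε ^ α * δ₁ ≤ M := by linarith
  have : IsFiniteMeasure (volume.restrict Ωε) :=
    ⟨by simpa using (hΩ_bdd.subset hΩε_sub).measure_lt_top⟩
  have hfε : MemLp f 2 (volume.restrict Ωε) := hf.mono_measure (Measure.restrict_mono_set _ hΩε_sub)
  have hF := hfε.coeFn_toLp
  have hRs : ∀ a b : ℝ, a ≤ b → R b - R a ∈ Icc 0 (δ₁ * (b - a)) :=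
    fun a b => hR.ac.sub_mem_Icc hR.deriv_bounds
  have hGs : ∀ k, 1 ≤ k → ∀ a b : ℝ, a ≤ b →
      Rreg (γ k) b - Rreg (γ k) a ∈ Icc 0 (δ₁ * (b - a)) := fun k hk a b =>
    (hRreg k hk).ac.sub_mem_Icc ((hRreg k hk).deriv_bounds.mono fun x hx =>
      ⟨(mul_pos (hγ_pos k hk) hR.delta_zero_pos).le.trans hx.1, hx.2⟩)
  obtain ⟨K, hK0, hK⟩ : ∃ K : ℝ, 0 < K ∧ ∀ u ∈ V Ω Ωε, ‖value u‖ ^ 2 ≤ K * ‖grad u‖ ^ 2 := by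
    -- A vanishing inverse constant would make the square root equal to 1, against ω > 0. As
    -- `toReal` sends ∞ to 0, this excludes C_p = ∞ and C_p = 0 alike.
    refine exists_poincare fun h0 => ?_
    rw [h0, mul_zero, zero_add, div_self hMpos.ne', Real.sqrt_one] at hω_bar
    linarith
  have hMκ : M < γlo / K + M := by linarith [div_pos hA.lo_pos hK0]
  obtain ⟨L, hL⟩ := exists_solutionOperator (S := V Ω Ωε)
    (Submodule.isClosed_topologicalClosure _) (shiftedForm hA ε M Ωε) (lt_min hA.lo_pos hMpos)
    (fun u _ => mul_norm_sq_le_shiftedForm hA ε M u) (valueL Ωε)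
  have hLκ := norm_val_solution_le hL (hMpos.trans hMκ)
    (fun u hu => mul_norm_value_sq_le_shiftedForm hA ε M hK0 (hK u hu))
  have hN := norm_linearizedSource_sub_le hfε.toLp hc.le hcM hRs
  obtain ⟨w, hw, hw_unique⟩ := existsUnique_fixedPoint hMpos.le hMκ hLκ hN
  have hseq := isLinearizedSequence_iff (α := α) hA hF hGs hL
  refine ⟨?_, fun u hu => ?_, w, (isWeakSolution_iff hA hF hRs hL w).2 hw,
    fun u hu => hw_unique u ((isWeakSolution_iff hA hF hRs hL u).1 hu)⟩
  · exact (existsUnique_congr hseq).2 (existsUnique_recursive_sequence 0 fun k v =>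
      L (linearizedSource hfε.toLp M (ε ^ α) (Rreg (γ (k + 1))) (valueL Ωε v)))
  · obtain ⟨-, hs⟩ := (hseq u).1 hu
    -- The signs of CR and C are not assumed; they follow from the error bound at k = 1 and the rate
    -- at k = 2.
    have hCR : 0 ≤ CR := by
      have h := (abs_nonneg _).trans ((hRreg 1 le_rfl).close 0)
      exact nonneg_of_mul_nonneg_left h (Real.rpow_pos_of_pos (hγ_pos 1 le_rfl) σ)
    have hC : 0 ≤ C := by
      have h := (div_nonneg (Real.rpow_nonneg (hγ_pos 1 le_rfl).le σ)
        (hγ_pos 2 one_le_two).le).trans (hγ_rate 2 le_rfl)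
      exact nonneg_of_mul_nonneg_left h (by positivity)
    have hrate := rpow_le_geometric hγ_pos hγ_anti hω_pos.le hω_lt.le hC hγ_rate
    have hγ1 := (hγ_pos 1 le_rfl).le
    have ht := tendsto_of_perturbed_iteration
      (Nk := fun k => linearizedSource hfε.toLp M (ε ^ α) (Rreg (γ (k + 1))))
      -- Collects ε^α, the factor |Ωε|^{1/2} from the uniform-to-L² bound, the regularization
      -- constant, and C γ_1 from the rate.
      (b := ε ^ α * (measureUnivNNReal (volume.restrict Ωε) ^ (2 : ℝ≥0∞).toReal⁻¹ *
        (CR * (C * γ 1)))) hMpos.le hMκ hLκ hN (by positivity) hω_pos.le hω_lt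
      (fun k v => (norm_linearizedSource_sub_le_of_close hfε.toLp hc.le
        (hGs (k + 1) (Nat.le_add_left 1 k)) hRs (hRreg (k + 1) (Nat.le_add_left 1 k)).close v).trans ?_) hw
      hs
    · exact ht.cauchySeq
    · rw [mul_assoc (ε ^ α), mul_assoc _ (CR * _), mul_assoc CR]
      gcongr
      exact hrate k
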